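/- Let $(M,\omega)$ be a connected (finite-dimensional, Hausdorff, second countable) smooth symplectic manifold without boundary, and let $G$ be a connected finite-dimensional Lie group acting smoothly and properly on $M$ by symplectic diffeomorphisms, i.e. $g^*\omega=\omega$ for all $g\in G$. For $f\in C^\infty(M)$ let $X_f$ be the vector field determined by $df=\omega(X_f,\cdot)$, and put $\{f_1,f_2\}=\omega(X_{f_1},X_{f_2})$. The action is called multiplicity-free if $\{f_1,f_2\}=0$ for all $G$-invariant $f_1,f_2\in C^\infty(M)^G$. A submanifold $N\subset M$ is called coisotropic if $(T_xN)^{\perp_\omega}=\{v\in T_xM:\omega(v,w)=0\ \ \forall w\in T_xN\}\subset T_xN$ for every $x\in N$, and the action is called coisotropic if there is an open dense subset $U\subset M$ such that the orbit $Gx$ is coisotropic for every $x\in U$. Then the action of $G$ on $M$ is multiplicity-free if and only if it is coisotropic. -/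

import Mathlib

open scoped Manifold ContDiff

section SymplecticDefs

variable {E : Type*} [NormedAddCommGroup E] [NormedSpace ℝ E]
  {H : Type*} [TopologicalSpace H] (I : ModelWithCorners ℝ E H)
  {M : Type*} [TopologicalSpace M] [ChartedSpace H M]

/-- The local representative, in the preferred chart at `c`, of a 2-form `σ` on `M`: the pullback
of `σ` under the inverse of the chart. It is meaningful on the target of the chart. -/
noncomputable def chartRep (σ : ∀ x : M, TangentSpace I x [⋀^Fin 2]→L[ℝ] ℝ) (c : M) (y : E) :
    E [⋀^Fin 2]→L[ℝ] ℝ :=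
  (σ ((extChartAt I c).symm y)).compContinuousLinearMap
    (mfderiv 𝓘(ℝ, E) I (extChartAt I c).symm y : E →L[ℝ] TangentSpace I ((extChartAt I c).symm y))

variable (M) in
/-- A symplectic form on a manifold `M` without boundary: a smooth, closed, nondegenerate
2-form. Smoothness and closedness are expressed in the charts. -/
structure SymplecticForm where
  /-- The alternating bilinear form on each tangent space. -/
  form : ∀ x : M, TangentSpace I x [⋀^Fin 2]→L[ℝ] ℝ
  smooth : ∀ c : M, ContDiffOn ℝ ∞ (chartRep I form c) (extChartAt I c).target
  closed : ∀ c : M, ∀ y ∈ (extChartAt I c).target, extDeriv (chartRep I form c) y = 0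
  nondegenerate : ∀ (x : M) (v : TangentSpace I x),
    (∀ w : TangentSpace I x, form x ![v, w] = 0) → v = 0

variable {I}

/-- On a finite-dimensional symplectic manifold, for every function `f` and point `x` there is a
unique tangent vector `v` at `x` with `σ(v, ·) = df`. -/
theorem SymplecticForm.existsUnique_hamiltonian [FiniteDimensional ℝ E] (σ : SymplecticForm I M)
    (f : M → ℝ) (x : M) :
    ∃! v : TangentSpace I x, ∀ w : TangentSpace I x,
      σ.form x ![v, w] = mfderiv I 𝓘(ℝ, ℝ) f x w := by
  have : FiniteDimensional ℝ (TangentSpace I x) := inferInstanceAs (FiniteDimensional ℝ E)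
  have hadd1 (u v w : TangentSpace I x) :
      σ.form x ![u + v, w] = σ.form x ![u, w] + σ.form x ![v, w] := by
    exact (σ.form x).toMultilinearMap.cons_add ![w] u v
  have hsmul1 (a : ℝ) (u w : TangentSpace I x) :
      σ.form x ![a • u, w] = a * σ.form x ![u, w] := by
    exact (σ.form x).toMultilinearMap.cons_smul ![w] a u
  have hswap (u v : TangentSpace I x) : σ.form x ![u, v] = - σ.form x ![v, u] := by
    have h := (σ.form x).toAlternatingMap.map_swap ![v, u] (i := 0) (j := 1) (by decide)
    have h2 : ![v, u] ∘ Equiv.swap (0 : Fin 2) 1 = ![u, v] := by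
      funext i; fin_cases i <;> simp
    rw [h2] at h
    exact h
  let flat : TangentSpace I x →ₗ[ℝ] Module.Dual ℝ (TangentSpace I x) :=
    LinearMap.mk₂ ℝ (fun v w => σ.form x ![v, w]) hadd1 (fun a u w => hsmul1 a u w)
      (fun u v w => by rw [hswap u, hadd1, hswap v u, hswap w u]; ring)
      (fun a u w => by rw [hswap u, hsmul1, hswap w u]; simp)
  have hinj : Function.Injective flat := by
    rw [injective_iff_map_eq_zero]
    intro v hv
    exact σ.nondegenerate x v fun w => LinearMap.congr_fun hv w
  have hsurj : Function.Surjective flat :=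
    (LinearMap.injective_iff_surjective_of_finrank_eq_finrank
      (Subspace.dual_finrank_eq).symm).1 hinj
  obtain ⟨v, hv⟩ := hsurj (mfderiv I 𝓘(ℝ, ℝ) f x).toLinearMap
  refine ⟨v, fun w => LinearMap.congr_fun hv w, fun v' hv' => hinj ?_⟩
  rw [hv]
  exact LinearMap.ext hv'

/-- The Hamiltonian vector field `X_f` of `f`, determined by `df = σ(X_f, ·)`. -/
noncomputable def SymplecticForm.hamiltonianField [FiniteDimensional ℝ E]
    (σ : SymplecticForm I M) (f : M → ℝ) (x : M) : TangentSpace I x :=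
  (σ.existsUnique_hamiltonian f x).choose

theorem SymplecticForm.hamiltonianField_spec [FiniteDimensional ℝ E]
    (σ : SymplecticForm I M) (f : M → ℝ) (x : M) (w : TangentSpace I x) :
    σ.form x ![σ.hamiltonianField f x, w] = mfderiv I 𝓘(ℝ, ℝ) f x w :=
  (σ.existsUnique_hamiltonian f x).choose_spec.1 w

/-- The Poisson bracket `{f, g} = σ(X_f, X_g)`. -/
noncomputable def SymplecticForm.poissonBracket [FiniteDimensional ℝ E]
    (σ : SymplecticForm I M) (f g : M → ℝ) (x : M) : ℝ :=
  σ.form x ![σ.hamiltonianField f x, σ.hamiltonianField g x]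

/-- `G` acts by symplectic diffeomorphisms: `g^* σ = σ` for every `g`. -/
def SymplecticForm.IsInvariant (σ : SymplecticForm I M) (G : Type*) [SMul G M] : Prop :=
  ∀ (g : G) (x : M) (v w : TangentSpace I x),
    σ.form (g • x) ![mfderiv I I (fun y : M => g • y) x v, mfderiv I I (fun y : M => g • y) x w] =
      σ.form x ![v, w]

/-- The action of `G` is multiplicity-free: the Poisson bracket of any two smooth `G`-invariant
functions vanishes identically. -/
def SymplecticForm.IsMultiplicityFree [FiniteDimensional ℝ E] (σ : SymplecticForm I M)
    (G : Type*) [SMul G M] : Prop :=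
  ∀ f₁ f₂ : M → ℝ, ContMDiff I 𝓘(ℝ, ℝ) ∞ f₁ → ContMDiff I 𝓘(ℝ, ℝ) ∞ f₂ →
    (∀ (g : G) (x : M), f₁ (g • x) = f₁ x) → (∀ (g : G) (x : M), f₂ (g • x) = f₂ x) →
    ∀ x : M, σ.poissonBracket f₁ f₂ x = 0

variable (I) in
/-- The tangent space at `x` of a submanifold `N` of `M`, as a subset of `T_x M`: the velocities
at time `0` of the smooth curves of `M` that run in `N` and are at `x` at time `0`. -/
def tangentSet (N : Set M) (x : M) : Set (TangentSpace I x) :=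
  {v | ∃ (γ : ℝ → M) (ε : ℝ), 0 < ε ∧ ContMDiffOn 𝓘(ℝ, ℝ) I ∞ γ (Set.Ioo (-ε) ε) ∧
    (∀ t ∈ Set.Ioo (-ε) ε, γ t ∈ N) ∧
    tangentMap 𝓘(ℝ, ℝ) I γ ⟨0, (1 : ℝ)⟩ = (⟨x, v⟩ : TangentBundle I M)}

/-- A submanifold `N` is coisotropic if the `σ`-orthogonal of `T_x N` lies in `T_x N` for every
`x` in `N`. -/
def SymplecticForm.IsCoisotropic (σ : SymplecticForm I M) (N : Set M) : Prop :=
  ∀ x ∈ N, {v : TangentSpace I x | ∀ w ∈ tangentSet I N x, σ.form x ![v, w] = 0} ⊆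
    tangentSet I N x

/-- The action of `G` is coisotropic: the orbits through the points of some open dense subset
of `M` are coisotropic. -/
def SymplecticForm.IsCoisotropicAction (σ : SymplecticForm I M) (G : Type*) [Group G]
    [MulAction G M] : Prop :=
  ∃ U : Set M, IsOpen U ∧ Dense U ∧ ∀ x ∈ U, σ.IsCoisotropic (MulAction.orbit G x)

end SymplecticDefs

open Set Filter Topology MeasureTheory

section LevelCurves

variable {E : Type*} [NormedAddCommGroup E] [NormedSpace ℝ E]

theorem ContinuousLinearMap.range_pi_eq_top_of_linearIndependent {k : ℕ} {l : Fin k → E →L[ℝ] ℝ}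
    (hl : LinearIndependent ℝ l) : (ContinuousLinearMap.pi l).range = ⊤ := by
  by_contra h
  obtain ⟨φ, hφ0, hφ⟩ := Submodule.exists_le_ker_of_lt_top _ (lt_top_iff_ne_top.2 h)
  apply hφ0
  have hsum : ∑ i, φ (Pi.single i 1) • l i = 0 := by
    ext v
    have hv : φ (ContinuousLinearMap.pi l v) = 0 := hφ ⟨v, rfl⟩
    rw [LinearMap.pi_apply_eq_sum_univ φ] at hv
    simp only [sum_apply, smul_apply, smul_eq_mul, zero_apply]
    rw [← hv]
    refine Finset.sum_congr rfl fun i _ => ?_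
    have hi : (Pi.single i 1 : Fin k → ℝ) = fun j => if i = j then 1 else 0 := by
      funext j
      simp [Pi.single_apply, eq_comm]
    rw [smul_eq_mul, mul_comm, hi]
    rfl
  have := Fintype.linearIndependent_iff.1 hl _ hsum
  ext i
  simpa using this i

theorem exists_curve_of_linearIndependent [FiniteDimensional ℝ E] {O : Set E} (hO : IsOpen O)
    {k : ℕ} {f : Fin k → E → ℝ} (hf : ∀ i, ContDiffOn ℝ ∞ (f i) O) {y : E} (hy : y ∈ O)
    (hli : LinearIndependent ℝ fun i => fderiv ℝ (f i) y) {v : E}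
    (hv : ∀ i, fderiv ℝ (f i) y v = 0) :
    ∃ (γ : ℝ → E) (ε : ℝ), 0 < ε ∧ ContDiffOn ℝ ∞ γ (Ioo (-ε) ε) ∧ γ 0 = y ∧ HasDerivAt γ v 0 ∧
      ∀ t ∈ Ioo (-ε) ε, γ t ∈ O ∧ ∀ i, f i (γ t) = f i y := by
  have : CompleteSpace E := FiniteDimensional.complete ℝ E
  set Φ : E → Fin k → ℝ := fun z i => f i z with hΦ
  have hΦs : ContDiffOn ℝ ∞ Φ O := contDiffOn_pi.2 hf
  set Φ' := ContinuousLinearMap.pi fun i => fderiv ℝ (f i) y with hΦ'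
  have hd : HasStrictFDerivAt Φ Φ' y := by
    refine hasStrictFDerivAt_pi.2 fun i => ?_
    exact ((hf i).contDiffAt (hO.mem_nhds hy)).hasStrictFDerivAt (by simp)
  have hrange : Φ'.range = ⊤ := ContinuousLinearMap.range_pi_eq_top_of_linearIndependent hli
  have hker := Φ'.ker_closedComplemented_of_finiteDimensional_range
  set D := hd.implicitFunctionDataOfComplemented Φ Φ' hrange hker with hD
  set e := D.toOpenPartialHomeomorph with he
  have hecoe : ⇑e = D.prodFun := D.toOpenPartialHomeomorph_coe
  have hprod : ∀ z ∈ O, ContDiffAt ℝ ∞ D.prodFun z := by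
    intro z hz
    have h1 : ContDiffAt ℝ ∞ D.leftFun z := hΦs.contDiffAt (hO.mem_nhds hz)
    have h2 : ContDiffAt ℝ ∞ D.rightFun z :=
      (Classical.choose hker).contDiff.contDiffAt.comp z (contDiffAt_id.sub contDiffAt_const)
    exact h1.prodMk h2
  have hyO : ∀ᶠ z in 𝓝 y, z ∈ O ∧ (fderiv ℝ D.prodFun z).IsInvertible := by
    refine (hO.eventually_mem hy).and ?_
    have hc : ContinuousAt (fderiv ℝ D.prodFun) y :=
      ((hprod y hy).fderiv_right (m := 0) (by simp)).continuousAt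
    obtain ⟨A, hA⟩ : (fderiv ℝ D.prodFun y).IsInvertible := D.isInvertible_fderiv_prodFun
    exact hc.eventually (ContinuousLinearEquiv.isOpen.eventually_mem ⟨A, hA⟩)
  have hvker : v ∈ Φ'.ker := by
    rw [LinearMap.mem_ker]
    ext i
    exact hv i
  set w : Φ'.ker := ⟨v, hvker⟩
  set c : ℝ → (Fin k → ℝ) × Φ'.ker := fun t => (Φ y, t • w)
  have hcs : ContDiff ℝ ∞ c := contDiff_const.prodMk (contDiff_id.smul contDiff_const)
  have hesrc : y ∈ e.source := D.pt_mem_toOpenPartialHomeomorph_source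
  have hey : e y = c 0 := by
    rw [hecoe]
    simp [c, hD]
  have hc0t : c 0 ∈ e.target := hey ▸ e.map_source hesrc
  have hsymm0 : e.symm (c 0) = y := by rw [← hey, e.left_inv hesrc]
  have hev : ∀ᶠ t in 𝓝 (0 : ℝ), c t ∈ e.target ∧
      (e.symm (c t) ∈ O ∧ (fderiv ℝ D.prodFun (e.symm (c t))).IsInvertible) := by
    have hcc : ContinuousAt c 0 := hcs.continuous.continuousAt
    refine (hcc.eventually (e.open_target.eventually_mem hc0t)).and ?_
    have : Tendsto (fun t => e.symm (c t)) (𝓝 0) (𝓝 y) := by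
      have h := ((e.continuousAt_symm hc0t).comp hcc).tendsto
      simpa only [Function.comp_def, hsymm0] using h
    exact this.eventually hyO
  obtain ⟨ε, hε, hball⟩ := Metric.eventually_nhds_iff.1 hev
  have hmem : ∀ t ∈ Ioo (-ε) ε, c t ∈ e.target ∧
      (e.symm (c t) ∈ O ∧ (fderiv ℝ D.prodFun (e.symm (c t))).IsInvertible) := by
    intro t ht
    exact hball (by simpa [abs_lt] using ht)
  have h0 : (0 : ℝ) ∈ Ioo (-ε) ε := by simp [hε]
  have hγs : ∀ t ∈ Ioo (-ε) ε, ContDiffAt ℝ ∞ (fun t => e.symm (c t)) t := by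
    intro t ht
    obtain ⟨h1, h2, A, hA⟩ := hmem t ht
    have hcd := hprod _ h2
    have : HasFDerivAt e (A : E →L[ℝ] _) (e.symm (c t)) := by
      rw [hA, hecoe]
      exact (hcd.differentiableAt (by simp)).hasFDerivAt
    exact (e.contDiffAt_symm h1 this (hecoe ▸ hcd)).comp t hcs.contDiffAt
  have hec : ∀ t ∈ Ioo (-ε) ε, D.prodFun (e.symm (c t)) = c t := by
    intro t ht
    rw [← hecoe, e.right_inv (hmem t ht).1]
  refine ⟨fun t => e.symm (c t), ε, hε, fun t ht => (hγs t ht).contDiffWithinAt, hsymm0, ?_,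
    fun t ht => ⟨(hmem t ht).2.1, fun i => congrFun (congrArg Prod.fst (hec t ht)) i⟩⟩
  have hγ0 : HasDerivAt (fun t => e.symm (c t)) (deriv (fun t => e.symm (c t)) 0) 0 :=
    ((hγs 0 h0).differentiableAt (by simp)).hasDerivAt
  have hP := D.hasStrictFDerivAt.hasFDerivAt
  have hpt : D.pt = e.symm (c 0) := hsymm0.symm
  have hcomp := (hpt ▸ hP).comp_hasDerivAt (0 : ℝ) hγ0
  have hc' : HasDerivAt c ((0 : Fin k → ℝ), w) 0 := by
    refine (hasDerivAt_const (0 : ℝ) (Φ y)).prodMk ?_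
    simpa using (hasDerivAt_id (0 : ℝ)).smul_const w
  have heq : D.prodFun ∘ (fun t => e.symm (c t)) =ᶠ[𝓝 0] c := by
    filter_upwards [Ioo_mem_nhds h0.1 h0.2] with t ht using hec t ht
  have hval := (hcomp.congr_of_eventuallyEq heq.symm).unique hc'
  set T := D.leftDeriv.equivProdOfSurjectiveOfIsCompl D.rightDeriv D.range_leftDeriv
    D.range_rightDeriv D.isCompl_ker
  have hTv : T v = ((0 : Fin k → ℝ), w) := by
    refine Prod.ext ?_ ?_
    · exact hvker
    · exact Classical.choose_spec hker w
  have : deriv (fun t => e.symm (c t)) 0 = v := T.injective (hval.trans hTv.symm)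
  exact this ▸ hγ0

/-- For a family `𝓕` of smooth functions on a nonempty open set `O`, there is a nonempty open
subset at every point of which each vector in the common kernel of the differentials of `𝓕` is the
velocity of a smooth curve along which all functions of `𝓕` are constant. -/
theorem exists_isOpen_forall_exists_curve [FiniteDimensional ℝ E] {O : Set E} (hO : IsOpen O)
    (hne : O.Nonempty) {𝓕 : Set (E → ℝ)} (h𝓕 : ∀ f ∈ 𝓕, ContDiffOn ℝ ∞ f O) :
    ∃ O' ⊆ O, IsOpen O' ∧ O'.Nonempty ∧ ∀ y ∈ O', ∀ v : E, (∀ f ∈ 𝓕, fderiv ℝ f y v = 0) →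
      ∃ (γ : ℝ → E) (ε : ℝ), 0 < ε ∧ ContDiffOn ℝ ∞ γ (Ioo (-ε) ε) ∧ γ 0 = y ∧ HasDerivAt γ v 0 ∧
        ∀ t ∈ Ioo (-ε) ε, γ t ∈ O' ∧ ∀ f ∈ 𝓕, f (γ t) = f y := by
  classical
  let P : ℕ → Prop := fun k => ∃ y ∈ O, ∃ f : Fin k → E → ℝ, (∀ i, f i ∈ 𝓕) ∧
    LinearIndependent ℝ fun i => fderiv ℝ (f i) y
  have hP0 : P 0 := by
    obtain ⟨y, hy⟩ := hne
    exact ⟨y, hy, Fin.elim0, fun i => i.elim0, linearIndependent_empty_type⟩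
  have hPb : ∀ k, P k → k ≤ Module.finrank ℝ (E →L[ℝ] ℝ) := by
    rintro k ⟨y, -, f, -, hli⟩
    simpa using hli.fintype_card_le_finrank
  set k := Nat.findGreatest P (Module.finrank ℝ (E →L[ℝ] ℝ)) with hk
  obtain ⟨y₀, hy₀, f, hf𝓕, hli⟩ : P k := Nat.findGreatest_spec (Nat.zero_le _) hP0
  have hmax : ∀ m, P m → m ≤ k := fun m hm => Nat.le_findGreatest (hPb m hm) hm
  set O' := {y ∈ O | LinearIndependent ℝ fun i => fderiv ℝ (f i) y} with hO'
  have hO'o : IsOpen O' := by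
    have hc : ContinuousOn (fun y i => fderiv ℝ (f i) y) O := continuousOn_pi.2 fun i =>
      (h𝓕 _ (hf𝓕 i)).continuousOn_fderiv_of_isOpen hO (by simp)
    exact hc.isOpen_inter_preimage hO isOpen_setOfPred_linearIndependent
  have hspan : ∀ y ∈ O', ∀ g ∈ 𝓕,
      fderiv ℝ g y ∈ Submodule.span ℝ (range fun i => fderiv ℝ (f i) y) := by
    intro y hy g hg
    by_contra hns
    have : P (k + 1) := by
      refine ⟨y, hy.1, Fin.snoc (α := fun _ => E → ℝ) f g, fun i => ?_, ?_⟩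
      · refine Fin.lastCases ?_ (fun j => ?_) i
        · simpa using hg
        · simpa using hf𝓕 j
      · have hsnoc : (fun i => fderiv ℝ (Fin.snoc (α := fun _ => E → ℝ) f g i) y) =
            Fin.snoc (α := fun _ => E →L[ℝ] ℝ) (fun i => fderiv ℝ (f i) y) (fderiv ℝ g y) := by
          funext i
          refine Fin.lastCases ?_ (fun j => ?_) i <;> simp
        rw [hsnoc]
        exact linearIndependent_finSnoc.2 ⟨hy.2, hns⟩
    exact absurd (hmax _ this) (by simp)
  have hker : ∀ y ∈ O', ∀ v, (∀ i, fderiv ℝ (f i) y v = 0) → ∀ g ∈ 𝓕, fderiv ℝ g y v = 0 := by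
    intro y hy v hv g hg
    have h := hspan y hy g hg
    generalize fderiv ℝ g y = l at h ⊢
    induction h using Submodule.span_induction with
    | mem x hx => obtain ⟨i, rfl⟩ := hx; exact hv i
    | zero => rfl
    | add a b _ _ ha hb => simp [ha, hb]
    | smul a b _ hb => simp [hb]
  refine ⟨O', fun y hy => hy.1, hO'o, ⟨y₀, hy₀, hli⟩, fun y hy v hv => ?_⟩
  obtain ⟨γ, ε, hε, hγs, hγ0, hγ', hγ⟩ := exists_curve_of_linearIndependent hO'o
    (fun i => (h𝓕 _ (hf𝓕 i)).mono fun y hy => hy.1) hy hy.2 fun i => hv _ (hf𝓕 i)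
  refine ⟨γ, ε, hε, hγs, hγ0, hγ', fun t ht => ⟨(hγ t ht).1, fun g hg => ?_⟩⟩
  have hd : ∀ s ∈ Ioo (-ε) ε, HasDerivAt γ (deriv γ s) s := fun s hs =>
    ((hγs.contDiffAt (isOpen_Ioo.mem_nhds hs)).differentiableAt (by simp)).hasDerivAt
  have hgd : ∀ g ∈ 𝓕, ∀ s ∈ Ioo (-ε) ε,
      HasDerivAt (fun s => g (γ s)) (fderiv ℝ g (γ s) (deriv γ s)) s := fun g hg s hs =>
    (((h𝓕 g hg).contDiffAt (hO.mem_nhds (hγ s hs).1.1)).differentiableAt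
      (by simp)).hasFDerivAt.comp_hasDerivAt s (hd s hs)
  have hzero : ∀ s ∈ Ioo (-ε) ε, fderiv ℝ g (γ s) (deriv γ s) = 0 := by
    intro s hs
    refine hker _ (hγ s hs).1 _ (fun i => ?_) g hg
    refine (hgd _ (hf𝓕 i) s hs).unique ((hasDerivAt_const s (f i y)).congr_of_eventuallyEq ?_)
    filter_upwards [isOpen_Ioo.mem_nhds hs] with r hr using (hγ r hr).2 i
  rw [← hγ0]
  refine isOpen_Ioo.is_const_of_deriv_eq_zero (f := fun s => g (γ s)) isPreconnected_Ioo
    (fun s hs => (hgd g hg s hs).differentiableAt.differentiableWithinAt)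
    (fun s hs => ?_) ht (by simp [hε])
  rw [(hgd g hg s hs).deriv, hzero s hs]
  rfl

end LevelCurves

section ParametricIntegral

variable {E : Type*} [NormedAddCommGroup E] [NormedSpace ℝ E]
  {F : Type*} [NormedAddCommGroup F] [NormedSpace ℝ F]
  {K : Type*} [TopologicalSpace K] {J : ModelWithCorners ℝ F K}
  {G : Type*} [TopologicalSpace G] [ChartedSpace K G] [IsManifold J ∞ G]

theorem ContMDiffOn.fderiv_fst {f : E → G → ℝ} {U : Set E} (hU : IsOpen U)
    (hf : ContMDiffOn (𝓘(ℝ, E).prod J) 𝓘(ℝ, ℝ) ∞ (Function.uncurry f) (U ×ˢ univ)) :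
    ContMDiffOn (𝓘(ℝ, E).prod J) 𝓘(ℝ, E →L[ℝ] ℝ) ∞
      (fun p : E × G => fderiv ℝ (fun y => f y p.2) p.1) (U ×ˢ univ) := by
  rintro ⟨y, g⟩ ⟨hy, -⟩
  have hfa : ContMDiffAt (𝓘(ℝ, E).prod J) 𝓘(ℝ, ℝ) ∞ (Function.uncurry f) (y, g) :=
    hf.contMDiffAt ((hU.prod isOpen_univ).mem_nhds ⟨hy, mem_univ _⟩)
  have hswap : ContMDiffAt ((𝓘(ℝ, E).prod J).prod 𝓘(ℝ, E)) 𝓘(ℝ, ℝ) ∞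
      (Function.uncurry fun (p : E × G) (z : E) => f z p.2) ((y, g), y) := by
    have h2 : ContMDiffAt ((𝓘(ℝ, E).prod J).prod 𝓘(ℝ, E)) (𝓘(ℝ, E).prod J) ∞
        (fun q : (E × G) × E => (q.2, q.1.2)) ((y, g), y) :=
      contMDiffAt_snd.prodMk (contMDiffAt_snd.comp _ contMDiffAt_fst)
    exact ContMDiffAt.comp (x := ((y, g), y)) (g := Function.uncurry f) hfa h2
  have := hswap.mfderiv (m := ∞) (fun (p : E × G) (z : E) => f z p.2) Prod.fst
    contMDiffAt_fst (by simp)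
  have heq := inTangentCoordinates_model_space (I := 𝓘(ℝ, E)) (I' := 𝓘(ℝ, ℝ))
    (Prod.fst : E × G → E) (fun p => f p.1 p.2)
    (fun p : E × G => mfderiv 𝓘(ℝ, E) 𝓘(ℝ, ℝ) (fun z => f z p.2) p.1) (y, g)
  have h := (congrArg (fun φ => ContMDiffAt (𝓘(ℝ, E).prod J) 𝓘(ℝ, E →L[ℝ] ℝ) ∞ φ (y, g))
    heq).mp this
  simpa only [mfderiv_eq_fderiv] using h.contMDiffWithinAt

variable [FiniteDimensional ℝ E] [MeasurableSpace G] [OpensMeasurableSpace G]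
  {μ : Measure G} [IsFiniteMeasureOnCompacts μ]

theorem hasFDerivAt_setIntegral_of_contMDiffOn {f : E → G → ℝ} {U : Set E} (hU : IsOpen U)
    (hf : ContMDiffOn (𝓘(ℝ, E).prod J) 𝓘(ℝ, ℝ) ∞ (Function.uncurry f) (U ×ˢ univ))
    {C : Set G} (hC : IsCompact C) (hCm : MeasurableSet C) {y : E} (hy : y ∈ U) :
    Integrable (fun g => fderiv ℝ (fun z => f z g) y) (μ.restrict C) ∧
      HasFDerivAt (fun y => ∫ g in C, f y g ∂μ)
        (∫ g in C, fderiv ℝ (fun z => f z g) y ∂μ) y := by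
  have hD := (hf.fderiv_fst hU).continuousOn
  have hfix : ∀ z ∈ U, Continuous fun g : G => (z, g) := fun z _ => by fun_prop
  have hfc : ∀ z ∈ U, Continuous (f z) := fun z hz =>
    hf.continuousOn.comp_continuous (hfix z hz) fun g => ⟨hz, mem_univ g⟩
  have hDc : ∀ z ∈ U, Continuous fun g => fderiv ℝ (fun z => f z g) z := fun z hz =>
    hD.comp_continuous (hfix z hz) fun g => ⟨hz, mem_univ g⟩
  obtain ⟨r, hr, hball⟩ := Metric.nhds_basis_closedBall.mem_iff.1 (hU.mem_nhds hy)
  obtain ⟨B, hB⟩ := ((isCompact_closedBall y r).prod hC).exists_bound_of_continuousOn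
    (hD.mono (prod_mono hball (subset_univ C)))
  have : IsFiniteMeasure (μ.restrict C) := ⟨by simpa using hC.measure_lt_top⟩
  refine ⟨(hDc y hy).continuousOn.integrableOn_compact' hC hCm, ?_⟩
  refine hasFDerivAt_integral_of_dominated_of_fderiv_le (F := f)
    (F' := fun z g => fderiv ℝ (fun z => f z g) z) (Metric.closedBall_mem_nhds y hr)
    (bound := fun _ => B) ?_ ((hfc y hy).continuousOn.integrableOn_compact' hC hCm)
    (hDc y hy).aestronglyMeasurable ?_ (integrable_const B) (Eventually.of_forall ?_)
  · filter_upwards [hU.mem_nhds hy] with z hz using (hfc z hz).aestronglyMeasurable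
  · exact ae_restrict_of_forall_mem hCm fun g hg z hz => hB (z, g) ⟨hz, hg⟩
  · intro g z hz
    have hfa : ContMDiffAt (𝓘(ℝ, E).prod J) 𝓘(ℝ, ℝ) ∞ (Function.uncurry f) (z, g) :=
      hf.contMDiffAt ((hU.prod isOpen_univ).mem_nhds ⟨hball hz, mem_univ _⟩)
    have : ContMDiffAt 𝓘(ℝ, E) 𝓘(ℝ, ℝ) ∞ (fun z => f z g) z :=
      ContMDiffAt.comp (g := Function.uncurry f) (f := fun z => (z, g)) z hfa
        (contMDiffAt_id.prodMk contMDiffAt_const)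
    exact (this.contDiffAt.differentiableAt (by simp)).hasFDerivAt

/-- The integral over a compact set of a smooth function on `U × G` depends smoothly on the
parameter in `U`. -/
theorem contDiffOn_setIntegral_of_contMDiffOn {f : E → G → ℝ} {U : Set E} (hU : IsOpen U)
    (hf : ContMDiffOn (𝓘(ℝ, E).prod J) 𝓘(ℝ, ℝ) ∞ (Function.uncurry f) (U ×ˢ univ))
    {C : Set G} (hC : IsCompact C) (hCm : MeasurableSet C) :
    ContDiffOn ℝ ∞ (fun y => ∫ g in C, f y g ∂μ) U := by
  refine contDiffOn_infty.2 fun n => ?_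
  induction n generalizing f with
  | zero =>
    exact contDiffOn_zero.2 fun y hy =>
      (hasFDerivAt_setIntegral_of_contMDiffOn hU hf hC hCm hy).2.continuousAt.continuousWithinAt
  | succ n ih =>
    push_cast
    refine (contDiffOn_succ_iff_fderiv_apply hU.uniqueDiffOn).2 ⟨fun y hy =>
      (hasFDerivAt_setIntegral_of_contMDiffOn hU hf hC hCm
        hy).2.differentiableAt.differentiableWithinAt, by simp, fun v => ?_⟩
    refine (ih (f := fun y g => fderiv ℝ (fun z => f z g) y v) ?_).congr fun y hy => ?_
    · exact (hf.fderiv_fst hU).clm_apply contMDiffOn_const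
    · obtain ⟨hi, hd⟩ := hasFDerivAt_setIntegral_of_contMDiffOn (μ := μ) hU hf hC hCm hy
      rw [fderivWithin_of_isOpen hU hy, hd.fderiv]
      exact ContinuousLinearMap.integral_apply hi v

end ParametricIntegral

section Averaging

variable {E : Type*} [NormedAddCommGroup E] [NormedSpace ℝ E] [FiniteDimensional ℝ E]
  {H : Type*} [TopologicalSpace H] {I : ModelWithCorners ℝ E H} [I.Boundaryless]
  {M : Type*} [TopologicalSpace M] [ChartedSpace H M] [IsManifold I ∞ M]
  {F : Type*} [NormedAddCommGroup F] [NormedSpace ℝ F] {K : Type*} [TopologicalSpace K]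
  {G : Type*} [Group G] [TopologicalSpace G] [MulAction G M]

theorem ProperSMul.isCompact_setOf_inv_smul_mem {X : Type*} [TopologicalSpace X] [MulAction G X]
    [ProperSMul G X] {A B : Set X} (hA : IsCompact A) (hB : IsCompact B) :
    IsCompact {g : G | ∃ x ∈ B, g⁻¹ • x ∈ A} := by
  have h := ((ProperSMul.isProperMap_smul_pair (G := G) (X := X)).isCompact_preimage
    (hB.prod hA)).image continuous_fst
  convert h using 1
  ext g
  simp only [mem_ofPred_eq, mem_image, mem_preimage, mem_prod, Prod.exists, exists_and_right,
    exists_eq_right]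
  constructor
  · rintro ⟨x, hx, hgx⟩
    exact ⟨g⁻¹ • x, by simpa using hx, hgx⟩
  · rintro ⟨x, hgx, hx⟩
    exact ⟨g • x, hgx, by simpa using hx⟩

theorem MulAction.isClosed_orbit_of_properSMul [ContinuousInv G] [ProperSMul G M] (x : M) :
    IsClosed (MulAction.orbit G x) := by
  have hx : MulAction.orbit G x =
      Quotient.mk (MulAction.orbitRel G M) ⁻¹' {Quotient.mk (MulAction.orbitRel G M) x} := by
    ext y
    simp only [mem_preimage, mem_singleton_iff]
    exact (Quotient.eq (r := MulAction.orbitRel G M)).symm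
  rw [hx]
  exact isClosed_singleton.preimage continuous_quotient_mk'

/-- The average of a compactly supported smooth function over a proper smooth action is smooth. -/
theorem contMDiff_integral_inv_smul [T2Space M] (J : ModelWithCorners ℝ F K) [ChartedSpace K G]
    [LieGroup J ∞ G] [ContMDiffSMul J I ∞ G M] [ProperSMul G M] [MeasurableSpace G] [BorelSpace G]
    {μ : Measure G} [IsFiniteMeasureOnCompacts μ]
    {f : M → ℝ} (hf : ContMDiff I 𝓘(ℝ, ℝ) ∞ f) (hfc : HasCompactSupport f) :
    ContMDiff I 𝓘(ℝ, ℝ) ∞ fun x => ∫ g : G, f (g⁻¹ • x) ∂μ := by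
  have : IsTopologicalGroup G := topologicalGroup_of_lieGroup J ∞
  have : LocallyCompactSpace M := Manifold.locallyCompact_of_finiteDimensional I
  intro x₀
  obtain ⟨B, hB, hx₀B⟩ := exists_compact_mem_nhds x₀
  set C := closure {g : G | ∃ x ∈ B, g⁻¹ • x ∈ tsupport f} with hCdef
  have hC : IsCompact C := (ProperSMul.isCompact_setOf_inv_smul_mem hfc hB).closure
  set e := extChartAt I x₀ with he
  have het : IsOpen e.target := isOpen_extChartAt_target x₀
  set U := e.target ∩ e.symm ⁻¹' interior B with hUdef
  have hU : IsOpen U := (continuousOn_extChartAt_symm x₀).isOpen_inter_preimage het isOpen_interior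
  have hsmooth : ContMDiffOn (𝓘(ℝ, E).prod J) 𝓘(ℝ, ℝ) ∞
      (Function.uncurry fun (y : E) (g : G) => f (g⁻¹ • e.symm y)) (U ×ˢ univ) := by
    have h1 : ContMDiffOn (𝓘(ℝ, E).prod J) I ∞ (fun p : E × G => e.symm p.1) (U ×ˢ univ) :=
      (contMDiffOn_extChartAt_symm x₀).comp contMDiffOn_fst fun p hp => hp.1.1
    have h2 : ContMDiffOn (𝓘(ℝ, E).prod J) J ∞ (fun p : E × G => p.2⁻¹) (U ×ˢ univ) :=
      ((contMDiff_inv J ∞).comp contMDiff_snd).contMDiffOn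
    have h3 : ContMDiffOn (𝓘(ℝ, E).prod J) I ∞ (fun p : E × G => p.2⁻¹ • e.symm p.1)
        (U ×ˢ univ) :=
      (contMDiff_smul (I := J) (I' := I) (n := ∞) (G := G) (M := M)).comp_contMDiffOn
        (h2.prodMk h1)
    exact hf.comp_contMDiffOn h3
  have hint := contDiffOn_setIntegral_of_contMDiffOn (μ := μ) hU hsmooth hC
    isClosed_closure.measurableSet
  have hx₀U : e x₀ ∈ U :=
    ⟨mem_extChartAt_target x₀, by
      simpa [he] using mem_interior_iff_mem_nhds.2 hx₀B⟩
  have hcomp : ContMDiffAt I 𝓘(ℝ, ℝ) ∞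
      ((fun y => ∫ g in C, f (g⁻¹ • e.symm y) ∂μ) ∘ e) x₀ :=
    ((hint.contDiffAt (hU.mem_nhds hx₀U)).contMDiffAt).comp x₀ contMDiffAt_extChartAt
  refine hcomp.congr_of_eventuallyEq ?_
  filter_upwards [extChartAt_source_mem_nhds (I := I) x₀, hx₀B] with x hx hxB
  simp only [Function.comp_apply, he, (extChartAt I x₀).left_inv hx]
  refine (setIntegral_eq_integral_of_forall_compl_eq_zero fun g hg => ?_).symm
  refine image_eq_zero_of_notMem_tsupport fun h => hg ?_
  exact subset_closure ⟨x, hxB, h⟩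

/-- Smooth invariant functions of a proper smooth action separate the orbits. -/
theorem exists_contMDiff_invariant_ne [T2Space M] [FiniteDimensional ℝ F]
    (J : ModelWithCorners ℝ F K) [ChartedSpace K G] [LieGroup J ∞ G] [ContMDiffSMul J I ∞ G M]
    [ProperSMul G M] {x y : M}
    (hxy : x ∉ MulAction.orbit G y) :
    ∃ h : M → ℝ, ContMDiff I 𝓘(ℝ, ℝ) ∞ h ∧ (∀ (g : G) (z : M), h (g • z) = h z) ∧ h x ≠ h y := by
  have : IsTopologicalGroup G := topologicalGroup_of_lieGroup J ∞
  have : LocallyCompactSpace G := Manifold.locallyCompact_of_finiteDimensional J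
  have hopen : (MulAction.orbit G y)ᶜ ∈ 𝓝 x :=
    (MulAction.isClosed_orbit_of_properSMul y).isOpen_compl.mem_nhds hxy
  obtain ⟨ρ, -, hρ⟩ := (SmoothBumpFunction.nhds_basis_tsupport (I := I) x).mem_iff.1 hopen
  borelize G
  let μ : Measure G := Measure.haar
  have hcont : Continuous fun g : G => ρ (g⁻¹ • x) :=
    ρ.contMDiff.continuous.comp (continuous_inv.smul continuous_const)
  have hcs : HasCompactSupport fun g : G => ρ (g⁻¹ • x) :=
    HasCompactSupport.intro (ProperSMul.isCompact_setOf_inv_smul_mem (G := G) ρ.hasCompactSupport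
      (isCompact_singleton (x := x))) fun g hg =>
        image_eq_zero_of_notMem_tsupport fun h => hg ⟨x, rfl, h⟩
  refine ⟨fun z => ∫ g : G, ρ (g⁻¹ • z) ∂μ,
    contMDiff_integral_inv_smul J ρ.contMDiff ρ.hasCompactSupport, fun g z => ?_, ?_⟩
  · have := integral_mul_left_eq_self (μ := μ) (fun k : G => ρ (k⁻¹ • g • z)) g
    refine this.symm.trans ?_
    simp [mul_smul]
  · have hpos : 0 < ∫ g : G, ρ (g⁻¹ • x) ∂μ :=
      hcont.integral_pos_of_hasCompactSupport_nonneg_nonzero hcs (fun g => ρ.nonneg)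
        (x := 1) (by simp)
    have hzero : ∫ g : G, ρ (g⁻¹ • y) ∂μ = 0 := by
      refine integral_eq_zero_of_ae (Eventually.of_forall fun g => ?_)
      exact image_eq_zero_of_notMem_tsupport fun h => hρ h ⟨g⁻¹, rfl⟩
    simp only [hzero]
    exact hpos.ne'

end Averaging

section AlternatingBilin

variable {V : Type*} [AddCommGroup V] [Module ℝ V] [TopologicalSpace V]

/-- The bilinear form underlying an alternating form of degree two. -/
def ContinuousAlternatingMap.toBilin (η : V [⋀^Fin 2]→L[ℝ] ℝ) : LinearMap.BilinForm ℝ V :=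
  have hadd (u v w : V) : η ![u + v, w] = η ![u, w] + η ![v, w] :=
    η.toMultilinearMap.cons_add ![w] u v
  have hsmul (a : ℝ) (u w : V) : η ![a • u, w] = a * η ![u, w] :=
    η.toMultilinearMap.cons_smul ![w] a u
  have hswap (u v : V) : η ![u, v] = - η ![v, u] := by
    have h := η.toAlternatingMap.map_swap ![v, u] (i := 0) (j := 1) (by decide)
    have h2 : ![v, u] ∘ Equiv.swap (0 : Fin 2) 1 = ![u, v] := by
      funext i; fin_cases i <;> simp
    rw [h2] at h
    exact h
  LinearMap.mk₂ ℝ (fun v w => η ![v, w]) hadd hsmul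
    (fun u v w => by rw [hswap u, hadd, hswap v u, hswap w u]; ring)
    (fun a u w => by rw [hswap u, hsmul, hswap w u]; simp)

theorem ContinuousAlternatingMap.toBilin_apply (η : V [⋀^Fin 2]→L[ℝ] ℝ) (v w : V) :
    η.toBilin v w = η ![v, w] := rfl

theorem ContinuousAlternatingMap.toBilin_isAlt (η : V [⋀^Fin 2]→L[ℝ] ℝ) : η.toBilin.IsAlt :=
  fun v => η.map_eq_zero_of_eq ![v, v] (i := 0) (j := 1) rfl (by decide)

theorem ContinuousAlternatingMap.toBilin_nondegenerate {η : V [⋀^Fin 2]→L[ℝ] ℝ}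
    (hη : ∀ v, (∀ w, η ![v, w] = 0) → v = 0) : η.toBilin.Nondegenerate :=
  ⟨fun v hv => hη v hv, fun v hv => hη v fun w => by
    have := η.toBilin_isAlt.neg_eq w v
    rw [hv w, neg_zero] at this
    exact this.symm⟩

end AlternatingBilin

section Charts

variable {E : Type*} [NormedAddCommGroup E] [NormedSpace ℝ E]
  {H : Type*} [TopologicalSpace H] {I : ModelWithCorners ℝ E H} [I.Boundaryless]
  {M : Type*} [TopologicalSpace M] [ChartedSpace H M] [IsManifold I ∞ M]

theorem mdifferentiableAt_extChartAt_symm_of_boundaryless {c : M} {y : E}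
    (hy : y ∈ (extChartAt I c).target) :
    MDifferentiableAt 𝓘(ℝ, E) I (extChartAt I c).symm y := by
  have h := mdifferentiableWithinAt_extChartAt_symm (I := I) hy
  rwa [I.range_eq_univ, mdifferentiableWithinAt_univ] at h

theorem isInvertible_mfderiv_extChartAt_symm {c : M} {y : E}
    (hy : y ∈ (extChartAt I c).target) :
    (mfderiv 𝓘(ℝ, E) I (extChartAt I c).symm y).IsInvertible := by
  have h := isInvertible_mfderivWithin_extChartAt_symm (I := I) hy
  rwa [I.range_eq_univ, mfderivWithin_univ] at h

omit [I.Boundaryless] in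
theorem contDiffOn_comp_extChartAt_symm {f : M → ℝ} (hf : ContMDiff I 𝓘(ℝ, ℝ) ∞ f) (c : M) :
    ContDiffOn ℝ ∞ (f ∘ (extChartAt I c).symm) (extChartAt I c).target :=
  (hf.comp_contMDiffOn (contMDiffOn_extChartAt_symm c)).contDiffOn

theorem fderiv_comp_extChartAt_symm {f : M → ℝ} (hf : ContMDiff I 𝓘(ℝ, ℝ) ∞ f) {c : M} {y : E}
    (hy : y ∈ (extChartAt I c).target) (v : E) :
    fderiv ℝ (f ∘ (extChartAt I c).symm) y v =
      mfderiv I 𝓘(ℝ, ℝ) f ((extChartAt I c).symm y)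
        (mfderiv 𝓘(ℝ, E) I (extChartAt I c).symm y v) := by
  rw [← mfderiv_eq_fderiv, mfderiv_comp y (hf.mdifferentiableAt (by simp))
    (mdifferentiableAt_extChartAt_symm_of_boundaryless hy)]
  rfl

namespace SymplecticForm

variable [FiniteDimensional ℝ E] (σ : SymplecticForm I M)

omit [I.Boundaryless] [IsManifold I ∞ M] in
theorem poissonBracket_eq_mfderiv (f g : M → ℝ) (x : M) :
    σ.poissonBracket f g x = mfderiv I 𝓘(ℝ, ℝ) f x (σ.hamiltonianField g x) :=
  σ.hamiltonianField_spec f x _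

/-- The local representative of a symplectic form, as a map from vectors to covectors. -/
noncomputable def chartFlat (c : M) (y : E) : E →L[ℝ] E →L[ℝ] ℝ :=
  LinearMap.toContinuousLinearMap
    ((LinearMap.toContinuousLinearMap (𝕜 := ℝ) (E := E) (F' := ℝ)).toLinearMap ∘ₗ
      (chartRep I σ.form c y).toBilin)

omit [I.Boundaryless] [IsManifold I ∞ M] in
theorem chartFlat_apply (c : M) (y u v : E) :
    σ.chartFlat c y u v = σ.form ((extChartAt I c).symm y)
      ![mfderiv 𝓘(ℝ, E) I (extChartAt I c).symm y u,
        mfderiv 𝓘(ℝ, E) I (extChartAt I c).symm y v] := by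
  change (σ.form ((extChartAt I c).symm y)) (_ ∘ ![u, v]) = _
  congr 1
  funext i
  fin_cases i <;> rfl

omit [I.Boundaryless] [IsManifold I ∞ M] in
theorem continuousOn_chartFlat (c : M) :
    ContinuousOn (σ.chartFlat c) (extChartAt I c).target := by
  refine continuousOn_clm_apply.2 fun u => continuousOn_clm_apply.2 fun v => ?_
  exact (ContinuousAlternatingMap.apply ℝ E ℝ ![u, v]).continuous.comp_continuousOn
    (σ.smooth c).continuousOn

theorem isInvertible_chartFlat {c : M} {y : E} (hy : y ∈ (extChartAt I c).target) :
    (σ.chartFlat c y).IsInvertible := by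
  have hA := isInvertible_mfderiv_extChartAt_symm hy
  have hinj : Function.Injective (σ.chartFlat c y).toLinearMap := by
    refine (injective_iff_map_eq_zero _).2 fun u hu => ?_
    have hAu : mfderiv 𝓘(ℝ, E) I (extChartAt I c).symm y u = 0 := by
      refine σ.nondegenerate _ _ fun w => ?_
      have h := σ.chartFlat_apply c y u
        ((mfderiv 𝓘(ℝ, E) I (extChartAt I c).symm y).inverse w)
      rw [hA.self_apply_inverse] at h
      rw [← h]
      exact congrFun (congrArg DFunLike.coe hu) _
    rw [← hA.inverse_apply_self u, hAu, map_zero]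
    rfl
  have hfr : Module.finrank ℝ E = Module.finrank ℝ (E →L[ℝ] ℝ) := by
    rw [← (LinearMap.toContinuousLinearMap (𝕜 := ℝ) (E := E) (F' := ℝ)).finrank_eq]
    exact Subspace.dual_finrank_eq.symm
  exact ⟨(LinearEquiv.ofInjectiveOfFinrankEq _ hinj hfr).toContinuousLinearEquiv, rfl⟩

theorem poissonBracket_extChartAt_symm {f g : M → ℝ} (hf : ContMDiff I 𝓘(ℝ, ℝ) ∞ f)
    (hg : ContMDiff I 𝓘(ℝ, ℝ) ∞ g) {c : M} {y : E} (hy : y ∈ (extChartAt I c).target) :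
    σ.poissonBracket f g ((extChartAt I c).symm y) =
      fderiv ℝ (f ∘ (extChartAt I c).symm) y
        ((σ.chartFlat c y).inverse (fderiv ℝ (g ∘ (extChartAt I c).symm) y)) := by
  set u := (σ.chartFlat c y).inverse (fderiv ℝ (g ∘ (extChartAt I c).symm) y)
  have hA := isInvertible_mfderiv_extChartAt_symm hy
  rw [σ.poissonBracket_eq_mfderiv, fderiv_comp_extChartAt_symm hf hy]
  congr 1
  refine (σ.existsUnique_hamiltonian g _).unique (σ.hamiltonianField_spec g _) fun w => ?_
  have h := σ.chartFlat_apply c y u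
    ((mfderiv 𝓘(ℝ, E) I (extChartAt I c).symm y).inverse w)
  rw [hA.self_apply_inverse] at h
  rw [← h, (σ.isInvertible_chartFlat hy).self_apply_inverse]
  refine (fderiv_comp_extChartAt_symm hg hy _).trans ?_
  rw [hA.self_apply_inverse]

theorem continuous_poissonBracket {f g : M → ℝ} (hf : ContMDiff I 𝓘(ℝ, ℝ) ∞ f)
    (hg : ContMDiff I 𝓘(ℝ, ℝ) ∞ g) : Continuous (σ.poissonBracket f g) := by
  have : CompleteSpace E := FiniteDimensional.complete ℝ E
  refine continuous_iff_continuousAt.2 fun c => ?_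
  have ht : (extChartAt I c).target ∈ 𝓝 (extChartAt I c c) := extChartAt_target_mem_nhds c
  have hct : extChartAt I c c ∈ (extChartAt I c).target := mem_extChartAt_target c
  have hfd : ∀ {h : M → ℝ}, ContMDiff I 𝓘(ℝ, ℝ) ∞ h →
      ContinuousAt (fderiv ℝ (h ∘ (extChartAt I c).symm)) (extChartAt I c c) := fun hh =>
    (((contDiffOn_comp_extChartAt_symm hh c).contDiffAt ht).fderiv_right
      (m := 0) (by simp)).continuousAt
  have hinv : ContinuousAt (fun y => (σ.chartFlat c y).inverse) (extChartAt I c c) := by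
    obtain ⟨A, hA⟩ := σ.isInvertible_chartFlat hct
    refine ContinuousAt.comp (g := ContinuousLinearMap.inverse) ?_
      ((σ.continuousOn_chartFlat c).continuousAt ht)
    rw [← hA]
    exact (contDiffAt_map_inverse (n := 0) A).continuousAt
  have hloc := (hfd hf).clm_apply (hinv.clm_apply (hfd hg))
  refine (hloc.comp (f := extChartAt I c) (continuousAt_extChartAt c)).congr ?_
  filter_upwards [extChartAt_source_mem_nhds (I := I) c] with x hx
  have h := σ.poissonBracket_extChartAt_symm hf hg ((extChartAt I c).map_source hx)
  rw [(extChartAt I c).left_inv hx] at h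
  exact h.symm

end SymplecticForm

end Charts

section InvariantFunctions

variable {E : Type*} [NormedAddCommGroup E] [NormedSpace ℝ E]
  {H : Type*} [TopologicalSpace H] {I : ModelWithCorners ℝ E H}
  {M : Type*} [TopologicalSpace M] [ChartedSpace H M]

variable (I M) in
/-- The smooth functions on `M` that are invariant under `G`. -/
def smoothInvariants (G : Type*) [SMul G M] : Set (M → ℝ) :=
  {h | ContMDiff I 𝓘(ℝ, ℝ) ∞ h ∧ ∀ (g : G) (x : M), h (g • x) = h x}

variable (I) in
/-- The common kernel at `x` of the differentials of the smooth `G`-invariant functions. -/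
def invariantKer (G : Type*) [SMul G M] (x : M) : Set (TangentSpace I x) :=
  {v | ∀ h ∈ smoothInvariants I M G, mfderiv I 𝓘(ℝ, ℝ) h x v = 0}

theorem tangentSet_orbit_subset_invariantKer {G : Type*} [Group G] [MulAction G M] {x₀ x : M} :
    tangentSet I (MulAction.orbit G x₀) x ⊆ invariantKer I G x := by
  rintro v ⟨γ, ε, hε, hγs, hγ, hv⟩ h ⟨hh, hinv⟩
  have h0 : (0 : ℝ) ∈ Ioo (-ε) ε := by simp [hε]
  have hconst : ∀ z ∈ MulAction.orbit G x₀, h z = h x₀ := by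
    rintro _ ⟨g, rfl⟩
    exact hinv g x₀
  have hγd : MDifferentiableAt 𝓘(ℝ, ℝ) I γ 0 :=
    (hγs.contMDiffAt (isOpen_Ioo.mem_nhds h0)).mdifferentiableAt (by simp)
  have hz : mfderiv 𝓘(ℝ, ℝ) 𝓘(ℝ, ℝ) (h ∘ γ) 0 = 0 := by
    have heq : (h ∘ γ) =ᶠ[𝓝 0] fun _ => h x₀ := by
      filter_upwards [isOpen_Ioo.mem_nhds h0] with t ht using hconst _ (hγ t ht)
    exact ((hasMFDerivAt_const (h x₀) (0 : ℝ)).congr_of_eventuallyEq heq).mfderiv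
  have hval := congrArg (fun p : TangentBundle I M => (mfderiv I 𝓘(ℝ, ℝ) h p.1 p.2 : ℝ)) hv
  refine hval.symm.trans ?_
  have hcomp := mfderiv_comp (0 : ℝ) (g := h) (f := γ) (hh.mdifferentiableAt (by simp)) hγd
  rw [hz] at hcomp
  exact (congrFun (congrArg DFunLike.coe hcomp) (1 : ℝ)).symm

theorem SymplecticForm.hamiltonianField_mem_invariantKer [FiniteDimensional ℝ E]
    {σ : SymplecticForm I M} {G : Type*} [SMul G M] (hσ : σ.IsMultiplicityFree G) {f : M → ℝ}
    (hf : f ∈ smoothInvariants I M G) (x : M) : σ.hamiltonianField f x ∈ invariantKer I G x :=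
  fun h hh => (σ.hamiltonianField_spec h x _).symm.trans (hσ h f hh.1 hf.1 hh.2 hf.2 x)

/-- For a multiplicity-free action, the common kernel of the differentials of the invariants is a
coisotropic subspace. -/
theorem SymplecticForm.mem_invariantKer_of_forall_form_eq_zero [FiniteDimensional ℝ E]
    {σ : SymplecticForm I M} {G : Type*} [SMul G M] (hσ : σ.IsMultiplicityFree G) {x : M}
    {v : TangentSpace I x} (hv : ∀ w ∈ invariantKer I G x, σ.form x ![v, w] = 0) :
    v ∈ invariantKer I G x := by
  have : FiniteDimensional ℝ (TangentSpace I x) := inferInstanceAs (FiniteDimensional ℝ E)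
  set B := (σ.form x).toBilin with hB
  have hrefl : B.IsRefl := (σ.form x).toBilin_isAlt.isRefl
  have hnd : B.Nondegenerate :=
    ContinuousAlternatingMap.toBilin_nondegenerate (σ.nondegenerate x)
  set D := Submodule.span ℝ ((fun f => σ.hamiltonianField f x) '' smoothInvariants I M G)
  have hDperp : ∀ w ∈ B.orthogonal D, w ∈ invariantKer I G x := fun w hw h hh =>
    (σ.hamiltonianField_spec h x w).symm.trans
      (LinearMap.BilinForm.mem_orthogonal_iff.1 hw _ (Submodule.subset_span ⟨h, hh, rfl⟩))
  have hvD : v ∈ D := by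
    rw [← LinearMap.BilinForm.orthogonal_orthogonal hnd hrefl D]
    exact LinearMap.BilinForm.mem_orthogonal_iff.2 fun w hw => hrefl _ _ (hv w (hDperp w hw))
  intro h hh
  have hle : D ≤ LinearMap.ker (mfderiv I 𝓘(ℝ, ℝ) h x).toLinearMap := by
    refine Submodule.span_le.2 ?_
    rintro _ ⟨f, hf, rfl⟩
    exact hamiltonianField_mem_invariantKer hσ hf x h hh
  exact hle hvD

theorem SymplecticForm.isMultiplicityFree_of_isCoisotropicAction [FiniteDimensional ℝ E]
    [I.Boundaryless] [IsManifold I ∞ M] {σ : SymplecticForm I M} {G : Type*} [Group G]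
    [MulAction G M] (hσ : σ.IsCoisotropicAction G) : σ.IsMultiplicityFree G := by
  obtain ⟨U, -, hUd, hU⟩ := hσ
  intro f₁ f₂ hf₁ hf₂ hi₁ hi₂
  have hcl : IsClosed {x | σ.poissonBracket f₁ f₂ x = 0} :=
    isClosed_eq (σ.continuous_poissonBracket hf₁ hf₂) continuous_const
  suffices h : U ⊆ {x | σ.poissonBracket f₁ f₂ x = 0} from
    fun x => hcl.closure_subset_iff.2 h (hUd x)
  intro x hx
  have hker : σ.hamiltonianField f₂ x ∈ invariantKer I G x :=
    tangentSet_orbit_subset_invariantKer (hU x hx x (MulAction.mem_orbit_self x) fun w hw =>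
      (σ.hamiltonianField_spec f₂ x w).trans
        (tangentSet_orbit_subset_invariantKer hw f₂ ⟨hf₂, hi₂⟩))
  exact (σ.poissonBracket_eq_mfderiv f₁ f₂ x).trans (hker f₁ ⟨hf₁, hi₁⟩)

theorem invariantKer_subset_tangentSet_smul {G : Type*} [Group G] [MulAction G M]
    (hG : ∀ g : G, ContMDiff I I ∞ fun x : M => g • x) (g : G) {x : M}
    (hx : invariantKer I G (g • x) ⊆ tangentSet I (MulAction.orbit G (g • x)) (g • x)) :
    invariantKer I G x ⊆ tangentSet I (MulAction.orbit G x) x := by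
  intro v hv
  have hd : ∀ (k : G) (z : M), MDifferentiableAt I I (fun x : M => k • x) z := fun k z =>
    (hG k).mdifferentiableAt (by simp)
  obtain ⟨γ, ε, hε, hγs, hγ, hγv⟩ := hx (a := mfderiv I I (fun x : M => g • x) x v) (by
    intro h hh
    have hcomp := mfderiv_comp x (hh.1.mdifferentiableAt (x := g • x) (by simp)) (hd g x)
    have heq : h ∘ (fun x : M => g • x) = h := funext fun z => hh.2 g z
    rw [heq] at hcomp
    exact (congrFun (congrArg DFunLike.coe hcomp) v).symm.trans (hv h hh))
  have h0 : (0 : ℝ) ∈ Ioo (-ε) ε := by simp [hε]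
  have hγd : MDifferentiableAt 𝓘(ℝ, ℝ) I γ 0 :=
    (hγs.contMDiffAt (isOpen_Ioo.mem_nhds h0)).mdifferentiableAt (by simp)
  refine ⟨fun t => g⁻¹ • γ t, ε, hε, (hG g⁻¹).comp_contMDiffOn hγs, fun t ht => ?_, ?_⟩
  · obtain ⟨k, hk⟩ := hγ t ht
    refine ⟨g⁻¹ * k * g, ?_⟩
    simp only at hk ⊢
    rw [← hk, mul_smul, mul_smul]
  · have h1 := tangentMap_comp_at (f := γ) (g := fun x : M => g⁻¹ • x) (I := 𝓘(ℝ, ℝ)) (I' := I)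
      (I'' := I) ⟨0, (1 : ℝ)⟩ (hd _ _) hγd
    have h2 := tangentMap_comp_at (f := fun x : M => g • x) (g := fun x : M => g⁻¹ • x) (I := I)
      (I' := I) (I'' := I) ⟨x, v⟩ (hd _ _) (hd _ _)
    have hid : (fun x : M => g⁻¹ • x) ∘ (fun x : M => g • x) = id := by
      funext z
      simp
    rw [hid, tangentMap_id] at h2
    refine h1.trans ?_
    rw [hγv]
    exact h2.symm

theorem dense_interior_invariantKer_subset_tangentSet [FiniteDimensional ℝ E] [I.Boundaryless]
    [IsManifold I ∞ M] {G : Type*} [Group G] [MulAction G M]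
    (hsep : ∀ x y : M, (∀ h ∈ smoothInvariants I M G, h x = h y) → x ∈ MulAction.orbit G y) :
    Dense (interior {x : M | invariantKer I G x ⊆ tangentSet I (MulAction.orbit G x) x}) := by
  refine dense_iff_inter_open.2 fun W hW hWne => ?_
  obtain ⟨c, hc⟩ := hWne
  set e := extChartAt I c with he
  have hO : IsOpen (e.target ∩ e.symm ⁻¹' W) :=
    (continuousOn_extChartAt_symm c).isOpen_inter_preimage (isOpen_extChartAt_target c) hW
  obtain ⟨O', hO'O, hO', ⟨y₀, hy₀⟩, hcurve⟩ := exists_isOpen_forall_exists_curve hO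
    ⟨e c, mem_extChartAt_target c, by simpa [he] using hc⟩
    (𝓕 := (fun h => h ∘ e.symm) '' smoothInvariants I M G) (by
      rintro _ ⟨h, hh, rfl⟩
      exact (contDiffOn_comp_extChartAt_symm hh.1 c).mono inter_subset_left)
  have hW' : IsOpen (e.source ∩ e ⁻¹' O') :=
    (continuousOn_extChartAt c).isOpen_inter_preimage (isOpen_extChartAt_source c) hO'
  have hy₀t : y₀ ∈ e.target := (hO'O hy₀).1
  refine ⟨e.symm y₀, (hO'O hy₀).2, mem_interior.2 ⟨_, ?_, hW', e.map_target hy₀t, ?_⟩⟩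
  swap
  · rwa [mem_preimage, e.right_inv hy₀t]
  rintro x ⟨hxs, hxO⟩
  obtain ⟨y, hy, hyO, rfl⟩ : ∃ y ∈ e.target, y ∈ O' ∧ e.symm y = x :=
    ⟨e x, e.map_source hxs, hxO, e.left_inv hxs⟩
  intro v hv
  have hA := isInvertible_mfderiv_extChartAt_symm hy
  set u : E := (mfderiv 𝓘(ℝ, E) I e.symm y).inverse v with hu
  have hAu : mfderiv 𝓘(ℝ, E) I e.symm y u = v := hA.self_apply_inverse v
  obtain ⟨γ, ε, hε, hγs, hγ0, hγ', hγ⟩ := hcurve y hyO u (by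
    rintro _ ⟨h, hh, rfl⟩
    refine (fderiv_comp_extChartAt_symm hh.1 hy u).trans ?_
    rw [hAu]
    exact hv h hh)
  have hmaps : MapsTo γ (Ioo (-ε) ε) e.target := fun t ht => (hO'O (hγ t ht).1).1
  refine ⟨e.symm ∘ γ, ε, hε,
    (contMDiffOn_extChartAt_symm c).comp hγs.contMDiffOn hmaps, fun t ht => ?_, ?_⟩
  · exact hsep _ _ fun h hh => (hγ t ht).2 _ ⟨h, hh, rfl⟩
  · subst hγ0
    have hγd : MDifferentiableAt 𝓘(ℝ, ℝ) 𝓘(ℝ, E) γ 0 := hγ'.differentiableAt.mdifferentiableAt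
    refine (tangentMap_comp_at (I' := 𝓘(ℝ, E)) _
      (mdifferentiableAt_extChartAt_symm_of_boundaryless hy) hγd).trans ?_
    have hγu : mfderiv 𝓘(ℝ, ℝ) 𝓘(ℝ, E) γ 0 (1 : ℝ) = u := by
      rw [mfderiv_eq_fderiv]
      exact hγ'.deriv
    rw [← hAu, ← hγu]
    rfl

end InvariantFunctions

theorem lemma3p3
    {E : Type*} [NormedAddCommGroup E] [NormedSpace ℝ E] [FiniteDimensional ℝ E]
    {H : Type*} [TopologicalSpace H] (I : ModelWithCorners ℝ E H) [I.Boundaryless]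
    (M : Type*) [TopologicalSpace M] [T2Space M] [SecondCountableTopology M] [ConnectedSpace M]
    [ChartedSpace H M] [IsManifold I ∞ M]
    {F : Type*} [NormedAddCommGroup F] [NormedSpace ℝ F] [FiniteDimensional ℝ F]
    {K : Type*} [TopologicalSpace K] (J : ModelWithCorners ℝ F K) [J.Boundaryless]
    (G : Type*) [Group G] [TopologicalSpace G] [ChartedSpace K G] [LieGroup J ∞ G]
    [ConnectedSpace G]
    [MulAction G M] [ContMDiffSMul J I ∞ G M] [ProperSMul G M]
    (σ : SymplecticForm I M) (hσ : σ.IsInvariant G) :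
    σ.IsMultiplicityFree G ↔ σ.IsCoisotropicAction G := by
  refine ⟨fun hmf => ?_, SymplecticForm.isMultiplicityFree_of_isCoisotropicAction⟩
  have hG : ∀ g : G, ContMDiff I I ∞ fun x : M => g • x := fun g =>
    (contMDiff_smul (I := J) (I' := I) (n := ∞) (G := G) (M := M)).comp
      (contMDiff_const.prodMk contMDiff_id)
  refine ⟨_, isOpen_interior, dense_interior_invariantKer_subset_tangentSet (I := I) (G := G)
    fun x y hxy => ?_, fun x hx => ?_⟩
  · by_contra hne
    obtain ⟨h, hh, hinv, hval⟩ := exists_contMDiff_invariant_ne (I := I) J hne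
    exact hval (hxy h ⟨hh, hinv⟩)
  · rintro _ ⟨g, rfl⟩ v hv
    have hsub := invariantKer_subset_tangentSet_smul (I := I) hG g⁻¹ (x := g • x) (by
      rw [inv_smul_smul]
      exact interior_subset hx)
    rw [MulAction.orbit_smul] at hsub
    exact hsub (SymplecticForm.mem_invariantKer_of_forall_form_eq_zero hmf fun w hw =>
      hv w (hsub hw))
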